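/- Let $\mathbb{Z}^2$ denote the square lattice (the Cayley graph of the group $\mathbb{Z}^2$ with generators $(1,0),(0,1)$). Let $\mu$ be a translation-invariant edge percolation measure on $\mathbb{Z}^2$, that is, a probability measure on $\{0,1\}^{E(\mathbb{Z}^2)}$ (with the product $\sigma$-algebra) that is invariant under the translation action of $\mathbb{Z}^2$. Identify a configuration with the spanning subgraph of its open edges (those with value $1$); its clusters are the connected components of this subgraph. Let $\mu^*$ be the dual measure on configurations on the planar dual graph: the vertices of the dual graph are the plaquettes (unit square faces) of $\mathbb{Z}^2$, each edge $e$ of $\mathbb{Z}^2$ corresponds to the dual edge $e^*$ joining the two plaquettes touching $e$, and $\mu^*$ is the law of the configuration $\omega^*$ given by $\omega^*_{e^*} = 1-\omega_e$, where $\omega$ has law $\mu$. Then $\mu$ has infinitely many infinite clusters with positive probability if and only if $\mu^*$ has infinitely many infinite clusters with positive probability. -/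

import Mathlib

open MeasureTheory

namespace Percolation

/-! ### Edge percolation on a graph -/

section Graph

variable {V : Type*} (G : SimpleGraph V)

/-- Configurations on `G`, that is, elements of `{0,1}^{E(G)}`: `true` is open, `false` is closed.
The product σ-algebra is the one Mathlib puts on a function type. -/
abbrev Config : Type _ := G.edgeSet → Bool

variable {G}

/-- The spanning subgraph of `G` whose edges are the open edges of `ω`. -/
def openSubgraph (ω : Config G) : SimpleGraph V :=
  SimpleGraph.fromEdgeSet {e | ∃ h : e ∈ G.edgeSet, ω ⟨e, h⟩ = true}

/-- A cluster is a connected component of the open subgraph. -/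
abbrev Cluster (ω : Config G) : Type _ := (openSubgraph ω).ConnectedComponent

/-- `ω` has infinitely many infinite clusters. -/
def HasInfinitelyManyInfiniteClusters (ω : Config G) : Prop :=
  {C : Cluster ω | C.supp.Infinite}.Infinite

end Graph

/-! ### The square lattice and its translations -/

/-- The square lattice: the Cayley graph of `ℤ²` with generators `(1,0)` and `(0,1)`. -/
def squareLattice : SimpleGraph (ℤ × ℤ) :=
  SimpleGraph.addCayley {((1 : ℤ), (0 : ℤ)), ((0 : ℤ), (1 : ℤ))}

theorem squareLattice_adj (u v : ℤ × ℤ) :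
    squareLattice.Adj u v ↔
      (u.2 = v.2 ∧ (v.1 = u.1 + 1 ∨ u.1 = v.1 + 1)) ∨
      (u.1 = v.1 ∧ (v.2 = u.2 + 1 ∨ u.2 = v.2 + 1)) := by
  obtain ⟨a, b⟩ := u
  obtain ⟨c, d⟩ := v
  simp only [squareLattice, SimpleGraph.addCayley_adj', Set.mem_insert_iff,
    Set.mem_singleton_iff, exists_eq_or_imp, exists_eq_left, Prod.mk_add_mk, Prod.mk.injEq, ne_eq]
  omega

/-- Translation by `t`, as an automorphism of the square lattice. -/
def translation (t : ℤ × ℤ) : squareLattice ≃g squareLattice where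
  toEquiv := Equiv.addRight t
  map_rel_iff' := by
    intro u v
    simp only [squareLattice_adj, Equiv.coe_addRight, Prod.fst_add, Prod.snd_add]
    omega

/-- The action of `ℤ²` on configurations: the edge `e + t` is open in the translate of `ω` by `t`
if and only if `e` is open in `ω`. -/
def translate (t : ℤ × ℤ) (ω : Config squareLattice) : Config squareLattice :=
  fun e => ω ((translation t).mapEdgeSet.symm e)

/-- A measure on configurations is translation-invariant if every translation preserves it. -/
def TranslationInvariant (μ : Measure (Config squareLattice)) : Prop :=
  ∀ t : ℤ × ℤ, MeasurePreserving (translate t) μ μ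

/-! ### Planar duality -/

/-- The plaquettes (faces) of the square lattice. The point `(x, y)` stands for the unit square
`[x, x+1] × [y, y+1]`, whose centre is `(x + 1/2, y + 1/2)`. -/
abbrev Plaquette : Type := ℤ × ℤ

/-- The four corners of a plaquette. -/
def Plaquette.corners (p : Plaquette) : Set (ℤ × ℤ) := Set.Icc p (p + (1, 1))

/-- The plaquette `p` touches the edge `e`: the edge is one of the four sides of the square. -/
def Plaquette.Touches (p : Plaquette) (e : squareLattice.edgeSet) : Prop :=
  ∀ v ∈ e.1, v ∈ p.corners

/-- The planar dual of the square lattice: its vertices are the plaquettes, and two distinct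
plaquettes are joined if they touch a common edge. -/
def dualLattice : SimpleGraph Plaquette where
  Adj p q := p ≠ q ∧ ∃ e : squareLattice.edgeSet, p.Touches e ∧ q.Touches e
  symm := ⟨fun _ _ ⟨h, e, hp, hq⟩ => ⟨h.symm, e, hq, hp⟩⟩
  loopless := ⟨fun _ h => h.1 rfl⟩

theorem dualLattice_adj (p q : Plaquette) : dualLattice.Adj p q ↔ squareLattice.Adj p q := by
  rw [squareLattice_adj]
  obtain ⟨a, b⟩ := p
  obtain ⟨c, d⟩ := q
  constructor
  · rintro ⟨hne, ⟨e, he⟩, hp, hq⟩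
    induction e using Sym2.ind with
    | _ u v =>
      obtain ⟨u1, u2⟩ := u
      obtain ⟨v1, v2⟩ := v
      rw [SimpleGraph.mem_edgeSet, squareLattice_adj] at he
      simp only [Plaquette.Touches, Plaquette.corners, Sym2.mem_iff, forall_eq_or_imp, forall_eq,
        Set.mem_Icc, Prod.mk_le_mk, Prod.mk_add_mk, ne_eq, Prod.mk.injEq] at hp hq hne he ⊢
      omega
  · intro h
    have he : s((a, b) ⊔ (c, d), (a, b) ⊓ (c, d) + ((1 : ℤ), (1 : ℤ))) ∈ squareLattice.edgeSet := by
      rw [SimpleGraph.mem_edgeSet, squareLattice_adj]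
      simp only [Prod.mk_sup_mk, Prod.mk_inf_mk, Prod.mk_add_mk] at h ⊢
      omega
    refine ⟨?_, ⟨_, he⟩, ?_⟩
    · simp only [ne_eq, Prod.mk.injEq] at h ⊢
      omega
    · simp only [Plaquette.Touches, Plaquette.corners, Sym2.mem_iff, forall_eq_or_imp, forall_eq,
        Set.mem_Icc, Prod.mk_le_mk, Prod.mk_add_mk, Prod.mk_sup_mk, Prod.mk_inf_mk] at h ⊢
      omega

/-- The natural identification of `E(ℤ²)` with the edge set of the planar dual. The edge `{u, v}`
corresponds to the dual edge that joins the two plaquettes touching it; the lower left corners of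
these are `u ⊓ v` and `u ⊔ v - (1, 1)`, with componentwise minimum and maximum. -/
def dualEdge : squareLattice.edgeSet ≃ dualLattice.edgeSet where
  toFun e := ⟨s(e.1.inf, e.1.sup - (1, 1)), by
    obtain ⟨e, he⟩ := e
    induction e using Sym2.ind with
    | _ u v =>
      obtain ⟨u1, u2⟩ := u
      obtain ⟨v1, v2⟩ := v
      rw [SimpleGraph.mem_edgeSet, squareLattice_adj] at he
      rw [SimpleGraph.mem_edgeSet, dualLattice_adj, squareLattice_adj]
      simp only [Sym2.inf_mk, Sym2.sup_mk, Prod.mk_sup_mk, Prod.mk_inf_mk, Prod.mk_sub_mk] at he ⊢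
      omega⟩
  invFun f := ⟨s(f.1.sup, f.1.inf + (1, 1)), by
    obtain ⟨e, he⟩ := f
    induction e using Sym2.ind with
    | _ u v =>
      obtain ⟨u1, u2⟩ := u
      obtain ⟨v1, v2⟩ := v
      rw [SimpleGraph.mem_edgeSet, dualLattice_adj, squareLattice_adj] at he
      rw [SimpleGraph.mem_edgeSet, squareLattice_adj]
      simp only [Sym2.inf_mk, Sym2.sup_mk, Prod.mk_sup_mk, Prod.mk_inf_mk, Prod.mk_add_mk] at he ⊢
      omega⟩
  left_inv e := by
    obtain ⟨e, he⟩ := e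
    induction e using Sym2.ind with
    | _ u v =>
      obtain ⟨u1, u2⟩ := u
      obtain ⟨v1, v2⟩ := v
      rw [SimpleGraph.mem_edgeSet, squareLattice_adj] at he
      simp only [Sym2.inf_mk, Sym2.sup_mk, Prod.mk_sup_mk, Prod.mk_inf_mk, Prod.mk_sub_mk,
        Prod.mk_add_mk, Subtype.mk.injEq, Sym2.eq_iff, Prod.mk.injEq] at he ⊢
      omega
  right_inv f := by
    obtain ⟨e, he⟩ := f
    induction e using Sym2.ind with
    | _ u v =>
      obtain ⟨u1, u2⟩ := u
      obtain ⟨v1, v2⟩ := v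
      rw [SimpleGraph.mem_edgeSet, dualLattice_adj, squareLattice_adj] at he
      simp only [Sym2.inf_mk, Sym2.sup_mk, Prod.mk_sup_mk, Prod.mk_inf_mk, Prod.mk_sub_mk,
        Prod.mk_add_mk, Subtype.mk.injEq, Sym2.eq_iff, Prod.mk.injEq] at he ⊢
      omega

/-- The ends of the dual edge of `e` are exactly the plaquettes that touch `e`. -/
theorem mem_dualEdge_iff (e : squareLattice.edgeSet) (p : Plaquette) :
    p ∈ (dualEdge e).1 ↔ p.Touches e := by
  obtain ⟨e, he⟩ := e
  obtain ⟨a, b⟩ := p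
  induction e using Sym2.ind with
  | _ u v =>
    obtain ⟨u1, u2⟩ := u
    obtain ⟨v1, v2⟩ := v
    rw [SimpleGraph.mem_edgeSet, squareLattice_adj] at he
    simp only [dualEdge, Equiv.coe_fn_mk, Plaquette.Touches, Plaquette.corners, Sym2.mem_iff,
      forall_eq_or_imp, forall_eq, Set.mem_Icc, Prod.mk_le_mk, Prod.mk_add_mk, Sym2.inf_mk,
      Sym2.sup_mk, Prod.mk_sup_mk, Prod.mk_inf_mk, Prod.mk_sub_mk, Prod.mk.injEq] at he ⊢
    omega

/-- The dual of a configuration: a dual edge is open if and only if the edge it crosses is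
closed. -/
def dualConfig (ω : Config squareLattice) : Config dualLattice :=
  fun f => !ω (dualEdge.symm f)

theorem measurable_dualConfig : Measurable dualConfig :=
  measurable_pi_lambda _ fun f => (measurable_of_countable Bool.not).comp
    (measurable_pi_apply (dualEdge.symm f))

/-- The dual measure `μ*`: the law of the dual of a configuration with law `μ`. -/
noncomputable def dualMeasure (μ : Measure (Config squareLattice)) : Measure (Config dualLattice) :=
  μ.map dualConfig

end Percolation

/-!
By the argument of Burton and Keane, a translation-invariant random subgraph of the square lattice
almost surely has no finite connected vertex set whose removal leaves three infinite components
adjacent to it. Hence, if such a graph has only `N` infinite clusters, then at most `2 * N` infinite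
components remain after the removal of any finite set.

On the other hand, let `G` have infinite clusters `A₀, …, Aₙ`, and for `i ≥ 1` join a ray in `A₀` to
a ray in `Aᵢ` by a finite path. The resulting bi-infinite path is a cycle, so it is the boundary of
some `2`-chain, a function `φᵢ` on the plaquettes. This function is constant along the edges of the
dual graph `H`, except near the finite path. A nonzero combination of the `φᵢ` that vanished on all
infinite components of `H ∖ K`, for a large finite set `K`, would turn the same combination of the
finite paths into a finite chain with the same boundary inside `G`, which is absurd because the
clusters `Aᵢ` are distinct. So `H ∖ K` has at least `n` infinite components, and infinitely many
infinite clusters of `G` force infinitely many infinite clusters of `H`. As `G` is, up to a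
translation, the dual of `H`, the converse holds as well.
-/

namespace Percolation

section Counting

variable {ι κ α : Type*} [Finite κ] [Nonempty κ]

theorem exists_isGreatest_forall_exists_ge [LinearOrder α] {Y : Finset α} {B : κ → Set α}
    (hY : ∀ c, (↑Y ∩ B c).Nonempty) :
    ∃ y c, IsGreatest (↑Y ∩ B c) y ∧ ∀ c', ∃ z ∈ ↑Y ∩ B c', y ≤ z := by
  have hlast (c : κ) : ∃ y, IsGreatest (↑Y ∩ B c) y :=
    (Y.finite_toSet.inter_of_left _).exists_maximal (hY c) |>.imp fun _ ↦ maximal_iff_isGreatest.1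
  choose last hlast using hlast
  obtain ⟨c, hc⟩ := Finite.exists_min last
  exact ⟨last c, c, hlast c, fun c' ↦ ⟨last c', (hlast c').1, hc c'⟩⟩

/-- Each index `i` selects the branch `B i c` whose last point of `Y` comes first. No branch of
another index can then have the same last point. -/
theorem card_le_card_of_laminar [Finite ι] {Y : Finset α} {B : ι → κ → Set α}
    (hY : ∀ i c, (↑Y ∩ B i c).Nonempty)
    (hdisj : ∀ i, Pairwise fun c d ↦ Disjoint (B i c) (B i d))
    (hcross : ∀ i j, i ≠ j → ∀ c d, ¬Disjoint (B i c) (B j d) →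
      (∃ c' ≠ c, B i c' ⊆ B j d) ∨ ∃ d' ≠ d, B j d' ⊆ B i c) :
    Nat.card ι ≤ Y.card := by
  let _ : LinearOrder α := IsWellOrder.linearOrder WellOrderingRel
  choose y c hy hge using fun i ↦ exists_isGreatest_forall_exists_ge (hY i)
  have hno (i j : ι) (hij : y i = y j) (c' : κ) (hc' : c' ≠ c i) : ¬B i c' ⊆ B j (c j) := by
    intro hsub
    obtain ⟨z, ⟨hzY, hz⟩, hyz⟩ := hge i c'
    have hzy : z = y i := le_antisymm (hij ▸ (hy j).2 ⟨hzY, hsub hz⟩) hyz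
    exact Set.disjoint_left.1 (hdisj i hc') hz (hzy ▸ (hy i).1.2)
  have hinj : Function.Injective y := by
    intro i j hij
    by_contra hne
    have hmeet : ¬Disjoint (B i (c i)) (B j (c j)) :=
      Set.not_disjoint_iff.2 ⟨y i, (hy i).1.2, hij ▸ (hy j).1.2⟩
    obtain ⟨c', hc', hsub⟩ | ⟨d', hd', hsub⟩ :=
      hcross i j hne _ _ hmeet
    · exact hno i j hij c' hc' hsub
    · exact hno j i hij.symm d' hd' hsub
  simpa using Nat.card_le_card_of_injective (fun i ↦ (⟨y i, (hy i).1.1⟩ : Y))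
    fun i j hij ↦ hinj (congrArg Subtype.val hij)

end Counting

section Branching

variable {V : Type*} {G : SimpleGraph V} {J K S : Set V}

theorem subset_componentCompl (hS : (G.induce S).Preconnected) (hSK : Disjoint S K)
    {C : G.ComponentCompl K} (hSC : ¬Disjoint S C) : S ⊆ C := by
  obtain ⟨v, hvS, hvK, rfl⟩ := Set.not_disjoint_iff.1 hSC
  intro w hwS
  have hvw := (hS ⟨w, hwS⟩ ⟨v, hvS⟩).map (G.induceHomOfLE hSK.subset_compl_right).toHom
  exact ⟨Set.disjoint_left.1 hSK hwS, SimpleGraph.ConnectedComponent.sound hvw⟩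

theorem preconnected_componentCompl (C : G.ComponentCompl K) :
    (G.induce (C : Set V)).Preconnected := by
  obtain ⟨u, hu⟩ := C.nonempty
  refine (G.induce_connected_of_patches u hu fun {v} hv ↦ ?_).preconnected
  obtain ⟨huK, rfl⟩ := hu
  obtain ⟨hvK, hvC⟩ := hv
  obtain ⟨p⟩ := SimpleGraph.ConnectedComponent.exact hvC.symm
  let q := p.map (SimpleGraph.Embedding.induce Kᶜ).toHom
  have hq := q.connected_induce_support.preconnected
  have hqK : Disjoint {x | x ∈ q.support} K := by
    rw [Set.disjoint_left]
    intro x hx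
    obtain ⟨y, -, rfl⟩ := List.mem_map.1 (SimpleGraph.Walk.support_map _ p ▸ hx)
    exact y.2
  have hqC := subset_componentCompl hq hqK
    (Set.not_disjoint_iff.2 ⟨u, q.start_mem_support, G.componentComplMk_mem huK⟩)
  exact ⟨_, hqC, q.start_mem_support, q.end_mem_support, hq _ _⟩

theorem componentCompl_subset_of_adj {C : G.ComponentCompl K} {D : G.ComponentCompl J}
    (hCJ : Disjoint (C : Set V) J) {v k : V} (hv : v ∈ C) (hk : k ∈ D) (hvk : G.Adj v k) :
    (C : Set V) ⊆ D :=
  subset_componentCompl (preconnected_componentCompl C) hCJ <| Set.not_disjoint_iff.2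
    ⟨v, hv, SimpleGraph.ComponentCompl.mem_of_adj k v hk (Set.disjoint_left.1 hCJ hv) hvk.symm⟩

/-- A branch of a vertex set `K`: an infinite component of `G ∖ K` that is adjacent to `K`. -/
def IsBranch (C : G.ComponentCompl K) : Prop :=
  (C : Set V).Infinite ∧ ∃ v ∈ C, ∃ k ∈ K, G.Adj v k

/-- A branching set, the analogue for finite connected sets of the encounter points of Burton and
Keane: its removal leaves at least three branches. -/
def IsBranching (G : SimpleGraph V) (K : Finset V) : Prop :=
  (G.induce (K : Set V)).Preconnected ∧
    ∃ C : Fin 3 → G.ComponentCompl (K : Set V), C.Injective ∧ ∀ i, IsBranch (C i)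

theorem exists_ne_disjoint_componentCompl {C : Fin 3 → G.ComponentCompl K} (hC : C.Injective)
    (hJ : (G.induce J).Preconnected) (hJK : Disjoint J K) (c : Fin 3) :
    ∃ c' ≠ c, Disjoint (C c' : Set V) J := by
  have hthree : ∀ c : Fin 3, ∃ c' ≠ c, ∃ c'' ≠ c, c' ≠ c'' := by decide
  obtain ⟨c', hc', c'', hc'', hne⟩ := hthree c
  by_contra! hmeet
  have hsub (i : Fin 3) (hi : i ≠ c) : J ⊆ C i :=
    subset_componentCompl hJ hJK fun h ↦ hmeet i hi h.symm
  exact hmeet c' hc' <|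
    (SimpleGraph.ComponentCompl.pairwise_disjoint (hC.ne hne)).mono_right (hsub c'' hc'')

theorem exists_branch_subset_or_subset (hK : (G.induce K).Preconnected)
    (hJ : (G.induce J).Preconnected) (hKJ : Disjoint K J) {C : Fin 3 → G.ComponentCompl K}
    {D : Fin 3 → G.ComponentCompl J} (hC : C.Injective) (hD : D.Injective)
    (hCK : ∀ i, IsBranch (C i)) (hDJ : ∀ i, IsBranch (D i)) {c d : Fin 3}
    (hmeet : ¬Disjoint (C c : Set V) (D d)) :
    (∃ c' ≠ c, (C c' : Set V) ⊆ D d) ∨ ∃ d' ≠ d, (D d' : Set V) ⊆ C c := by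
  by_cases hCJ : Disjoint (C c : Set V) J
  · left
    have hCD : (C c : Set V) ⊆ D d :=
      subset_componentCompl (preconnected_componentCompl _) hCJ hmeet
    have hKD : K ⊆ D d := by
      obtain ⟨-, v, hv, k, hk, hvk⟩ := hCK c
      have hkD := (D d).mem_of_adj v k (hCD hv) (Set.disjoint_left.1 hKJ hk) hvk
      exact subset_componentCompl hK hKJ (Set.not_disjoint_iff.2 ⟨k, hk, hkD⟩)
    obtain ⟨c', hc', hc'J⟩ := exists_ne_disjoint_componentCompl hC hJ hKJ.symm c
    obtain ⟨-, v, hv, k, hk, hvk⟩ := hCK c'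
    exact ⟨c', hc', componentCompl_subset_of_adj hc'J hv (hKD hk) hvk⟩
  · right
    have hJC : J ⊆ C c := subset_componentCompl hJ hKJ.symm fun h ↦ hCJ h.symm
    obtain ⟨d', hd', hd'K⟩ := exists_ne_disjoint_componentCompl hD hK hKJ d
    obtain ⟨-, v, hv, k, hk, hvk⟩ := hDJ d'
    exact ⟨d', hd', componentCompl_subset_of_adj hd'K hv (hJC hk) hvk⟩

theorem card_le_card_of_isBranching {ι : Type*} [Finite ι] {K : ι → Finset V} {Y : Finset V}
    (hK : ∀ i, IsBranching G (K i)) (hdisj : Pairwise fun i j ↦ Disjoint (K i) (K j))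
    (hY : ∀ i, ∀ C : G.ComponentCompl (K i : Set V), IsBranch C → (↑Y ∩ (C : Set V)).Nonempty) :
    Nat.card ι ≤ Y.card := by
  choose hconn C hinj hbranch using hK
  refine card_le_card_of_laminar (B := fun i c ↦ (C i c : Set V))
    (fun i c ↦ hY i _ (hbranch i c))
    (fun i c d hcd ↦ SimpleGraph.ComponentCompl.pairwise_disjoint ((hinj i).ne hcd)) ?_
  intro i j hij c d
  exact exists_branch_subset_or_subset (hconn i) (hconn j) (Finset.disjoint_coe.2 (hdisj hij))
    (hinj i) (hinj j) (hbranch i) (hbranch j)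

end Branching

section ExistsBranching

variable {V : Type*} {G : SimpleGraph V} {K : Set V}

/-- The set of infinite connected components of a graph. -/
def infiniteComponents (G : SimpleGraph V) : Set G.ConnectedComponent :=
  {C | C.supp.Infinite}

theorem exists_finset_preconnected (C : G.ConnectedComponent) (K : Finset V) :
    ∃ J : Finset V, J.Nonempty ∧ (J : Set V) ⊆ C.supp ∧ ↑K ∩ C.supp ⊆ J ∧
      (G.induce (J : Set V)).Preconnected := by
  classical
  obtain ⟨v, hv⟩ := C.nonempty_supp
  obtain ⟨J, hKJ, hJ⟩ := (G.induce C.supp).extend_finset_to_connected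
    C.connected_toSimpleGraph.preconnected
    (t := insert ⟨v, hv⟩ (K.subtype (· ∈ C.supp))) (Finset.insert_nonempty _ _)
  refine ⟨J.map (.subtype _), ⟨v, ?_⟩, ?_, ?_, ?_⟩
  · exact Finset.mem_map_of_mem _ (hKJ (Finset.mem_insert_self _ _))
  · simp +contextual
  · rintro k ⟨hkK, hkC⟩
    exact Finset.mem_map_of_mem (.subtype _)
      (hKJ (Finset.mem_insert_of_mem (Finset.mem_subtype (a := ⟨k, hkC⟩).2 hkK)))
  · let f : (G.induce C.supp).induce (J : Set C.supp) →g
        G.induce ((J.map (.subtype _) : Finset V) : Set V) :=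
      ⟨fun x ↦ ⟨x.1.1, Finset.mem_map_of_mem _ x.2⟩, id⟩
    refine hJ.preconnected.map f ?_
    rintro ⟨x, hx⟩
    obtain ⟨y, hy, rfl⟩ := Finset.mem_map.1 hx
    exact ⟨⟨y, hy⟩, rfl⟩

theorem finite_setOf_componentCompl_adj (hG : ∀ v, (G.neighborSet v).Finite) (hK : K.Finite) :
    {D : G.ComponentCompl K | ∃ v ∈ D, ∃ k ∈ K, G.Adj v k}.Finite := by
  have hN : (⋃ k ∈ K, G.neighborSet k).Finite := hK.biUnion fun k _ ↦ hG k
  refine ((hN.preimage Subtype.val_injective.injOn).image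
    fun v : ↥Kᶜ ↦ G.componentComplMk v.2).subset ?_
  rintro D ⟨v, ⟨hvK, rfl⟩, k, hk, hvk⟩
  exact ⟨⟨v, hvK⟩, Set.mem_biUnion hk hvk.symm, rfl⟩

theorem exists_adj_of_reachable {D : G.ComponentCompl K} {v k : V} (hv : v ∈ D) (hk : k ∈ K)
    (hvk : G.Reachable v k) : ∃ x ∈ D, ∃ y ∈ K, G.Adj x y := by
  obtain ⟨p⟩ := hvk
  obtain ⟨⟨⟨x, y⟩, hxy⟩, -, hxD, hyD⟩ :=
    p.exists_boundary_dart (D : Set V) hv (Set.disjoint_left.1 D.disjoint_right hk)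
  exact ⟨x, hxD, y, by_contra fun hyK ↦ hyD (D.mem_of_adj x y hxD hyK hxy), hxy⟩

theorem exists_isBranch_subset (hG : ∀ v, (G.neighborSet v).Finite) {C : G.ComponentCompl K}
    (hC : (C : Set V).Infinite) {A : G.ConnectedComponent} (hCA : (C : Set V) ⊆ A.supp)
    {J : Finset V} (hJ : J.Nonempty) (hJA : (J : Set V) ⊆ A.supp) (hKJ : K ∩ A.supp ⊆ J) :
    ∃ D : G.ComponentCompl (J : Set V), IsBranch D ∧ (D : Set V) ⊆ C := by
  obtain ⟨j, hj⟩ := hJ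
  by_contra! hno
  let T := {D : G.ComponentCompl (J : Set V) |
    (∃ v ∈ D, ∃ k ∈ (J : Set V), G.Adj v k) ∧ ¬Disjoint (D : Set V) C}
  have hT : T.Finite :=
    (finite_setOf_componentCompl_adj hG J.finite_toSet).subset fun D hD ↦ hD.1
  have hTfin (D) (hD : D ∈ T) : (D : Set V).Finite := by
    obtain ⟨hadj, hmeet⟩ := hD
    obtain ⟨v, hvD, hvC⟩ := Set.not_disjoint_iff.1 hmeet
    have hconn := preconnected_componentCompl D
    have hDK : Disjoint (D : Set V) K := by
      refine Set.disjoint_left.2 fun k hkD hkK ↦ D.notMem_of_mem hkD (hKJ ⟨hkK, ?_⟩)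
      have hkv := (hconn ⟨k, hkD⟩ ⟨v, hvD⟩).map (SimpleGraph.Embedding.induce _).toHom
      exact (SimpleGraph.ConnectedComponent.sound hkv).trans (hCA hvC)
    exact by_contra fun hinf ↦ hno D ⟨hinf, hadj⟩ (subset_componentCompl hconn hDK hmeet)
  refine hC ((J.finite_toSet.union (hT.biUnion hTfin)).subset fun v hvC ↦ ?_)
  by_cases hvJ : v ∈ (J : Set V)
  · exact Or.inl hvJ
  · have hv := G.componentComplMk_mem hvJ
    have hvj := A.reachable_of_mem_supp (hCA hvC) (hJA hj)
    exact Or.inr (Set.mem_biUnion ⟨exists_adj_of_reachable hv hj hvj,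
      Set.not_disjoint_iff.2 ⟨v, hv, hvC⟩⟩ hv)

theorem exists_isBranching (hG : ∀ v, (G.neighborSet v).Finite) {K : Finset V}
    {C : Fin 3 → G.ComponentCompl (K : Set V)} (hinj : C.Injective)
    (hinf : ∀ i, (C i : Set V).Infinite) {A : G.ConnectedComponent}
    (hCA : ∀ i, (C i : Set V) ⊆ A.supp) : ∃ J, IsBranching G J := by
  obtain ⟨J, hJ, hJA, hKJ, hconn⟩ := exists_finset_preconnected A K
  choose D hD hDC using fun i ↦ exists_isBranch_subset hG (hinf i) (hCA i) hJ hJA hKJ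
  refine ⟨J, hconn, D, fun i k hik ↦ by_contra fun hne ↦ ?_, hD⟩
  obtain ⟨v, hv⟩ := (D i).nonempty
  have hdisj := SimpleGraph.ComponentCompl.pairwise_disjoint (hinj.ne hne)
  exact Set.disjoint_left.1 hdisj (hDC i hv) (hDC k (hik ▸ hv))

theorem card_le_of_forall_not_isBranching (hG : ∀ v, (G.neighborSet v).Finite)
    (hno : ∀ J, ¬IsBranching G J) (hfin : (infiniteComponents G).Finite) {K : Finset V}
    (s : Finset (G.ComponentCompl (K : Set V))) (hs : ∀ C ∈ s, (C : Set V).Infinite) :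
    s.card ≤ 2 * (infiniteComponents G).ncard := by
  classical
  let f (C : G.ComponentCompl (K : Set V)) : G.ConnectedComponent :=
    C.map (SimpleGraph.Embedding.induce (K : Set V)ᶜ).toHom
  have hf (C : G.ComponentCompl (K : Set V)) : (C : Set V) ⊆ (f C).supp := by
    rintro v ⟨hv, rfl⟩
    rfl
  rw [Set.ncard_eq_toFinset_card _ hfin]
  refine Finset.card_le_mul_card_image_of_maps_to (f := f)
    (fun C hC ↦ hfin.mem_toFinset.2 ((hs C hC).mono (hf C))) 2 fun A _ ↦ ?_
  by_contra! hlt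
  obtain ⟨C, hC⟩ := Function.Embedding.exists_of_card_le_finset
    (α := Fin 3) (by rwa [Fintype.card_fin])
  have hCs (i) : C i ∈ s ∧ f (C i) = A := Finset.mem_filter.1 (hC ⟨i, rfl⟩)
  obtain ⟨J, hJ⟩ := exists_isBranching hG C.injective (fun i ↦ hs _ (hCs i).1)
    fun i ↦ (hCs i).2 ▸ hf (C i)
  exact hno J hJ

end ExistsBranching

section Transport

variable {V W : Type*} {G : SimpleGraph V} {H : SimpleGraph W}

theorem IsBranching.map_iso (φ : G ≃g H) {K : Finset V} (hK : IsBranching G K) :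
    IsBranching H (K.map φ.toEquiv.toEmbedding) := by
  obtain ⟨hconn, C, hinj, hC⟩ := hK
  have hbij : Set.BijOn φ (K : Set V) (K.map φ.toEquiv.toEmbedding : Finset W) := by
    rw [Finset.coe_map]
    exact φ.injective.injOn.bijOn_image
  let ψ := φ.induce (hbij.compl φ.bijective)
  have hψ (i) {v : V} (hv : v ∈ C i) : φ v ∈ (ψ.connectedComponentEquiv (C i) :
      H.ComponentCompl (K.map φ.toEquiv.toEmbedding : Set W)) := by
    obtain ⟨hvK, hvC⟩ := hv
    exact ⟨(ψ ⟨v, hvK⟩).2, hvC ▸ rfl⟩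
  refine ⟨(φ.induce hbij).preconnected_iff.1 hconn, fun i ↦ ψ.connectedComponentEquiv (C i),
    ψ.connectedComponentEquiv.injective.comp hinj, fun i ↦ ⟨?_, ?_⟩⟩
  · refine ((hC i).1.image φ.injective.injOn).mono ?_
    rintro _ ⟨v, hv, rfl⟩
    exact hψ i hv
  · obtain ⟨-, v, hv, k, hk, hvk⟩ := hC i
    exact ⟨φ v, hψ i hv, φ k, hbij.mapsTo hk, φ.map_adj_iff.2 hvk⟩

theorem isBranching_map_iso_iff (φ : G ≃g H) {K : Finset V} :
    IsBranching H (K.map φ.toEquiv.toEmbedding) ↔ IsBranching G K := by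
  refine ⟨fun hK ↦ ?_, .map_iso φ⟩
  have hid : φ.toEquiv.toEmbedding.trans φ.symm.toEquiv.toEmbedding = .refl V :=
    Function.Embedding.ext φ.symm_apply_apply
  simpa only [Finset.map_map, hid, Finset.map_refl] using hK.map_iso φ.symm

theorem isBranch_mk_iff_reachable {K : Set V} (a : (Kᶜ : Set V)) :
    IsBranch (G.componentComplMk a.2) ↔
      (∀ F : Finset (Kᶜ : Set V), ∃ w ∉ F, (G.induce Kᶜ).Reachable w a) ∧
      ∃ w : (Kᶜ : Set V), (G.induce Kᶜ).Reachable w a ∧ ∃ k ∈ K, G.Adj w k := by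
  have hmem (w : (Kᶜ : Set V)) :
      (w : V) ∈ G.componentComplMk a.2 ↔ (G.induce Kᶜ).Reachable w a :=
    ⟨fun ⟨_, h⟩ ↦ SimpleGraph.ConnectedComponent.exact h,
      fun h ↦ ⟨w.2, SimpleGraph.ConnectedComponent.sound h⟩⟩
  have hval : (G.componentComplMk a.2 : Set V) =
      Subtype.val '' {w | (G.induce Kᶜ).Reachable w a} :=
    Set.ext fun v ↦ ⟨fun hv ↦ ⟨⟨v, hv.1⟩, (hmem _).1 hv, rfl⟩, fun ⟨w, hw, hwv⟩ ↦
      hwv ▸ (hmem w).2 hw⟩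
  refine and_congr ?_ ⟨fun ⟨v, hv, h⟩ ↦ ⟨⟨v, hv.1⟩, (hmem _).1 hv, h⟩,
    fun ⟨w, hw, h⟩ ↦ ⟨w, (hmem w).2 hw, h⟩⟩
  rw [hval, Set.infinite_image_iff Subtype.val_injective.injOn]
  refine ⟨fun h F ↦ (h.exists_notMem_finset F).imp fun _ ↦ And.symm, fun h hfin ↦ ?_⟩
  obtain ⟨w, hwF, hw⟩ := h hfin.toFinset
  exact hwF (hfin.mem_toFinset.2 hw)

theorem isBranching_iff_reachable {K : Finset V} :
    IsBranching G K ↔ (∀ a b : (K : Set V), (G.induce (K : Set V)).Reachable a b) ∧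
      ∃ a : Fin 3 → ((K : Set V)ᶜ : Set V),
        (∀ i j, (G.induce (K : Set V)ᶜ).Reachable (a i) (a j) → i = j) ∧
        ∀ i, (∀ F : Finset ((K : Set V)ᶜ : Set V),
          ∃ w ∉ F, (G.induce (K : Set V)ᶜ).Reachable w (a i)) ∧
          ∃ w, (G.induce (K : Set V)ᶜ).Reachable w (a i) ∧ ∃ k ∈ (K : Set V), G.Adj w k := by
  refine and_congr Iff.rfl ?_
  constructor
  · rintro ⟨C, hinj, hC⟩
    choose a ha using fun i ↦ (C i).exists_rep
    obtain rfl : (fun i ↦ G.componentComplMk (a i).2) = C := funext ha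
    exact ⟨a, fun i j h ↦ hinj (SimpleGraph.ConnectedComponent.sound h),
      fun i ↦ (isBranch_mk_iff_reachable _).1 (hC i)⟩
  · rintro ⟨a, hinj, ha⟩
    exact ⟨fun i ↦ G.componentComplMk (a i).2,
      fun i j h ↦ hinj i j (SimpleGraph.ConnectedComponent.exact h),
      fun i ↦ (isBranch_mk_iff_reachable _).2 (ha i)⟩

end Transport

section Measurability

variable {Ω V : Type*} [MeasurableSpace Ω] [Countable V] {X : Ω → SimpleGraph V}

theorem measurable_exists_walk_length_eq (hX : ∀ u v, Measurable fun ω ↦ (X ω).Adj u v) (n : ℕ) :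
    ∀ u v, Measurable fun ω ↦ ∃ p : (X ω).Walk u v, p.length = n := by
  induction n with
  | zero =>
    intro u v
    simp only [SimpleGraph.Walk.exists_length_eq_zero_iff]
    exact measurable_const
  | succ n ih =>
    intro u v
    have hsucc (ω : Ω) : (∃ p : (X ω).Walk u v, p.length = n + 1) ↔
        ∃ w, (X ω).Adj u w ∧ ∃ p : (X ω).Walk w v, p.length = n := by
      constructor
      · rintro ⟨_ | ⟨huw, p⟩, hp⟩
        · simp at hp
        · exact ⟨_, huw, p, by simpa using hp⟩
      · rintro ⟨w, huw, p, rfl⟩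
        exact ⟨.cons huw p, rfl⟩
    simp only [hsucc]
    exact .exists fun w ↦ (hX u w).and (ih w v)

theorem measurable_reachable (hX : ∀ u v, Measurable fun ω ↦ (X ω).Adj u v) (u v : V) :
    Measurable fun ω ↦ (X ω).Reachable u v := by
  have hiff (ω : Ω) : (X ω).Reachable u v ↔ ∃ n, ∃ p : (X ω).Walk u v, p.length = n :=
    ⟨fun ⟨p⟩ ↦ ⟨_, p, rfl⟩, fun ⟨_, p, _⟩ ↦ ⟨p⟩⟩
  simp only [hiff]
  exact .exists fun n ↦ measurable_exists_walk_length_eq hX n u v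

theorem measurable_isBranching (hX : ∀ u v, Measurable fun ω ↦ (X ω).Adj u v) (K : Finset V) :
    Measurable fun ω ↦ IsBranching (X ω) K := by
  have hreach (s : Set V) (a b : s) : Measurable fun ω ↦ ((X ω).induce s).Reachable a b :=
    measurable_reachable (X := fun ω ↦ (X ω).induce s) (fun u v ↦ hX u v) a b
  simp only [isBranching_iff_reachable]
  refine .and (.forall fun a ↦ .forall fun b ↦ hreach _ a b) (.exists fun a ↦ .and
    (.forall fun i ↦ .forall fun j ↦ (hreach _ _ _).imp measurable_const) (.forall fun i ↦ .and
    (.forall fun F ↦ .exists fun w ↦ .and measurable_const (hreach _ _ _))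
    (.exists fun w ↦ (hreach _ _ _).and (.exists fun k ↦ .and measurable_const (hX _ _)))))

end Measurability

section BurtonKeane

variable {Ω : Type*} [MeasurableSpace Ω] {μ : Measure Ω}

theorem card_mul_le_mul_measure_univ {ι : Type*} [Fintype ι] {E : ι → Set Ω}
    (hE : ∀ i, MeasurableSet (E i)) {p : ENNReal} (hp : ∀ i, p ≤ μ (E i)) {N : ℕ}
    (hN : ∀ ω, {i | ω ∈ E i}.ncard ≤ N) : Fintype.card ι * p ≤ N * μ Set.univ := by
  classical
  have hsum (ω : Ω) : ∑ i, (E i).indicator 1 ω = ({i | ω ∈ E i}.ncard : ENNReal) := by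
    simp [Set.indicator_apply, Set.ncard_eq_toFinset_card']
  calc Fintype.card ι * p = ∑ _i : ι, p := by simp
    _ ≤ ∑ i, μ (E i) := Finset.sum_le_sum fun i _ ↦ hp i
    _ = ∫⁻ ω, ∑ i, (E i).indicator 1 ω ∂μ := by
      rw [lintegral_finsetSum _ fun i _ ↦ measurable_one.indicator (hE i)]
      simp only [lintegral_indicator_one (hE _)]
    _ ≤ ∫⁻ _ω, N ∂μ := lintegral_mono fun ω ↦ by
      rw [hsum]
      exact Nat.cast_le.2 (hN ω)
    _ = N * μ Set.univ := lintegral_const _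

theorem finite_neighborSet_of_le_squareLattice {G : SimpleGraph (ℤ × ℤ)} (hG : G ≤ squareLattice)
    (v : ℤ × ℤ) : (G.neighborSet v).Finite := by
  refine (Set.finite_Icc (v - 1) (v + 1)).subset fun w hw ↦ ?_
  have hvw := (squareLattice_adj v w).1 (hG hw)
  simp only [Set.mem_Icc, Prod.le_def, Prod.fst_sub, Prod.snd_sub, Prod.fst_add, Prod.snd_add,
    Prod.fst_one, Prod.snd_one]
  omega

theorem mem_Icc_neg_natCast_iff {n : ℕ} {v : ℤ × ℤ} :
    v ∈ Finset.Icc (-n : ℤ × ℤ) n ↔ max v.1.natAbs v.2.natAbs ≤ n := by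
  simp only [Finset.mem_Icc, Prod.le_def, Prod.fst_neg, Prod.snd_neg, Prod.fst_natCast,
    Prod.snd_natCast]
  omega

theorem exists_mem_box {G : SimpleGraph (ℤ × ℤ)} (hG : G ≤ squareLattice) {S : Set (ℤ × ℤ)}
    (hS : (G.induce S).Preconnected) (hinf : S.Infinite) {R : ℕ} {v : ℤ × ℤ} (hv : v ∈ S)
    (hvR : max v.1.natAbs v.2.natAbs ≤ R) : (↑(Finset.box R : Finset (ℤ × ℤ)) ∩ S).Nonempty := by
  obtain ⟨w, hw, hwR⟩ := hinf.exists_notMem_finset (Finset.Icc (-R : ℤ × ℤ) R)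
  obtain ⟨p⟩ := hS ⟨v, hv⟩ ⟨w, hw⟩
  obtain ⟨⟨⟨x, y⟩, hxy⟩, -, hx, hy⟩ := p.exists_boundary_dart
    {x | max x.1.1.natAbs x.1.2.natAbs ≤ R} hvR (mt mem_Icc_neg_natCast_iff.2 hwR)
  refine ⟨x, Int.mem_box.2 ?_, x.2⟩
  have hadj : squareLattice.Adj x y := hG hxy
  simp only [squareLattice_adj, Set.mem_ofPred_eq] at hadj hx hy
  omega

/-- The scaled lattice points `(2n+1)(i, j)`, `i, j < m`. -/
def gridPoint (n m : ℕ) (t : Fin m × Fin m) : ℤ × ℤ :=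
  ((2 * n + 1) * (t.1 : ℤ), (2 * n + 1) * (t.2 : ℤ))

theorem disjoint_map_subRight_gridPoint {n m : ℕ} {K : Finset (ℤ × ℤ)}
    (hK : ∀ v ∈ K, max v.1.natAbs v.2.natAbs ≤ n) :
    Pairwise fun s t ↦ Disjoint (K.map (Equiv.subRight (gridPoint n m s)).toEmbedding)
      (K.map (Equiv.subRight (gridPoint n m t)).toEmbedding) := by
  intro s t hst
  have hcoord {a b : ℤ} {i j : Fin m} (ha : a.natAbs ≤ n) (hb : b.natAbs ≤ n)
      (hab : a - (2 * n + 1) * (i : ℤ) = b - (2 * n + 1) * j) : i = j := by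
    have hdvd : (2 * n + 1 : ℤ) ∣ a - b := ⟨i - j, by linarith⟩
    have hzero := Int.eq_zero_of_abs_lt_dvd hdvd (abs_lt.2 ⟨by omega, by omega⟩)
    have hij : (2 * n + 1 : ℤ) * i = (2 * n + 1) * j := by linarith
    exact Fin.ext (by exact_mod_cast mul_left_cancel₀ (by positivity) hij)
  refine Finset.disjoint_left.2 fun v hvs hvt ↦ hst ?_
  obtain ⟨a, ha, rfl⟩ := Finset.mem_map.1 hvs
  obtain ⟨b, hb, hab⟩ := Finset.mem_map.1 hvt
  obtain ⟨h₁, h₂⟩ := Prod.ext_iff.1 hab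
  have han := max_le_iff.1 (hK a ha)
  have hbn := max_le_iff.1 (hK b hb)
  exact Prod.ext (hcoord han.1 hbn.1 h₁.symm) (hcoord han.2 hbn.2 h₂.symm)

theorem ncard_isBranching_gridPoint_le {G : SimpleGraph (ℤ × ℤ)} (hG : G ≤ squareLattice)
    {n m : ℕ} {K : Finset (ℤ × ℤ)} (hK : ∀ v ∈ K, max v.1.natAbs v.2.natAbs ≤ n) :
    {t | IsBranching G (K.map (Equiv.subRight (gridPoint n m t)).toEmbedding)}.ncard ≤
      (Finset.box ((2 * n + 1) * m) : Finset (ℤ × ℤ)).card := by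
  refine card_le_card_of_isBranching (fun t ↦ t.2)
    (fun s t hst ↦ disjoint_map_subRight_gridPoint hK (Subtype.coe_ne_coe.2 hst)) ?_
  rintro t C ⟨hinf, v, hv, k, hk, hvk⟩
  refine exists_mem_box hG (preconnected_componentCompl C) hinf hv ?_
  obtain ⟨l, hl, rfl⟩ := Finset.mem_map.1 hk
  have hadj := (squareLattice_adj _ _).1 (hG hvk)
  have hscale (i : Fin m) : 0 ≤ (2 * n + 1) * (i : ℤ) ∧
      (2 * n + 1) * (i : ℤ) + (2 * n + 1) ≤ (2 * n + 1) * m := by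
    constructor
    · positivity
    · have hi : (i : ℤ) + 1 ≤ m := by exact_mod_cast i.2
      nlinarith
  have h₁ := hscale t.1.1
  have h₂ := hscale t.1.2
  have hln := hK l hl
  simp only [gridPoint, Equiv.coe_toEmbedding, Equiv.subRight_apply, Prod.fst_sub,
    Prod.snd_sub] at hadj
  zify
  rw [max_le_iff, abs_le, abs_le]
  omega

/-- Burton and Keane's argument: otherwise the expected number of branching translates of some set
in a large square would be of the order of its area, whereas it is at most of the order of its
perimeter. -/
theorem ae_forall_not_isBranching [IsFiniteMeasure μ] {X : Ω → SimpleGraph (ℤ × ℤ)}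
    (hX : ∀ u v, Measurable fun ω ↦ (X ω).Adj u v) (hle : ∀ ω, X ω ≤ squareLattice)
    {τ : ℤ × ℤ → Ω → Ω} (hτ : ∀ t, MeasurePreserving (τ t) μ μ)
    (hXτ : ∀ t ω, X (τ t ω) = (X ω).comap (Equiv.subRight t)) :
    ∀ᵐ ω ∂μ, ∀ K, ¬IsBranching (X ω) K := by
  refine ae_all_iff.2 fun K ↦ ?_
  obtain ⟨n, hn⟩ : ∃ n, ∀ v ∈ K, max v.1.natAbs v.2.natAbs ≤ n :=
    ⟨K.sup fun v ↦ max v.1.natAbs v.2.natAbs, fun v hv ↦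
      Finset.le_sup (f := fun v : ℤ × ℤ ↦ max v.1.natAbs v.2.natAbs) hv⟩
  let E (L : Finset (ℤ × ℤ)) : Set Ω := {ω | IsBranching (X ω) L}
  have hE (L) : MeasurableSet (E L) := measurableSet_setOfPred.2 (measurable_isBranching hX L)
  have hshift (t : ℤ × ℤ) : μ (E (K.map (Equiv.subRight t).toEmbedding)) = μ (E K) := by
    rw [← (hτ t).measure_preimage (hE K).nullMeasurableSet]
    congr 1
    ext ω
    simp only [E, Set.mem_preimage, Set.mem_ofPred_eq, hXτ]
    exact isBranching_map_iso_iff (SimpleGraph.Iso.comap (Equiv.subRight t) (X ω))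
  have hbound (m : ℕ) : ((m + 1 : ℕ) : ENNReal) * μ (E K) ≤ 8 * (2 * n + 1) * μ Set.univ := by
    have hcount := card_mul_le_mul_measure_univ (μ := μ) (fun t ↦ hE _) (fun t ↦ (hshift _).ge)
      fun ω ↦ ncard_isBranching_gridPoint_le (m := m + 1) (hle ω) hn
    rw [Int.card_box (by positivity), Fintype.card_prod, Fintype.card_fin] at hcount
    have hm : ((m + 1 : ℕ) : ENNReal) ≠ 0 := by simp
    rw [← ENNReal.mul_le_mul_iff_right hm (by finiteness)]
    calc _ ≤ _ := (by push_cast; ring_nf; rfl)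
      _ ≤ _ := hcount
      _ = _ := by push_cast; ring
  by_contra hpos
  obtain ⟨m, hm⟩ := ENNReal.exists_nat_mul_gt (a := μ (E K)) (b := 8 * (2 * n + 1) * μ Set.univ)
    (by simpa [ae_iff, E] using hpos) (by finiteness)
  exact (hm.trans_le (by gcongr; simp)).not_ge (hbound m)

end BurtonKeane

section Chains

/-- The edges of the square lattice, each oriented along its generator: the edge with source `p` and
direction `0` ends at `p + (1, 0)`, the one with direction `1` at `p + (0, 1)`. -/
structure OrientedEdge where
  /-- The generator along which the edge points. -/
  direction : Fin 2
  /-- The start of the edge. -/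
  source : ℤ × ℤ

namespace OrientedEdge

/-- The generator of `ℤ²` in direction `i`. -/
def unitVector (i : Fin 2) : ℤ × ℤ := ![(1, 0), (0, 1)] i

/-- The end of an oriented edge. -/
def target (e : OrientedEdge) : ℤ × ℤ := e.source + unitVector e.direction

/-- The plaquette to the left of an oriented edge, named by its lower left corner. -/
def leftFace (e : OrientedEdge) : ℤ × ℤ := e.source - ![0, (1, 0)] e.direction

/-- The plaquette to the right of an oriented edge, named by its lower left corner. -/
def rightFace (e : OrientedEdge) : ℤ × ℤ := e.source - ![(0, 1), 0] e.direction

theorem adj_iff_exists_ends {u v : ℤ × ℤ} :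
    squareLattice.Adj u v ↔ ∃ e : OrientedEdge, s(e.source, e.target) = s(u, v) := by
  obtain ⟨a, b⟩ := u
  obtain ⟨c, d⟩ := v
  constructor
  · rw [squareLattice_adj]
    rintro (⟨h, h' | h'⟩ | ⟨h, h' | h'⟩)
    exacts [⟨⟨0, a, b⟩, by simp_all [target, unitVector]⟩,
      ⟨⟨0, c, d⟩, by simp_all [target, unitVector]⟩,
      ⟨⟨1, a, b⟩, by simp_all [target, unitVector]⟩,
      ⟨⟨1, c, d⟩, by simp_all [target, unitVector]⟩]
  · rintro ⟨⟨i, p, q⟩, h⟩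
    rw [← SimpleGraph.mem_edgeSet, ← h, SimpleGraph.mem_edgeSet, squareLattice_adj]
    fin_cases i <;> simp [target, unitVector]

theorem adj_iff_exists_faces {u v : ℤ × ℤ} :
    squareLattice.Adj u v ↔ ∃ e : OrientedEdge, s(e.leftFace, e.rightFace) = s(u, v) := by
  obtain ⟨a, b⟩ := u
  obtain ⟨c, d⟩ := v
  constructor
  · rw [squareLattice_adj]
    rintro (⟨h, h' | h'⟩ | ⟨h, h' | h'⟩)
    exacts [⟨⟨1, c, d⟩, by simp_all [leftFace, rightFace]⟩,
      ⟨⟨1, a, b⟩, by simp_all [leftFace, rightFace]⟩,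
      ⟨⟨0, c, d⟩, by simp_all [leftFace, rightFace]⟩,
      ⟨⟨0, a, b⟩, by simp_all [leftFace, rightFace]⟩]
  · rintro ⟨⟨i, p, q⟩, h⟩
    rw [← SimpleGraph.mem_edgeSet, ← h, SimpleGraph.mem_edgeSet, squareLattice_adj]
    fin_cases i <;> simp [leftFace, rightFace]

end OrientedEdge

open OrientedEdge

variable {R : Type*} [CommRing R] {G : SimpleGraph (ℤ × ℤ)}

/-- The boundary of a `1`-chain, that is, inflow minus outflow at each vertex. The chains are
arbitrary functions, of finite or infinite support. -/
def boundary : (OrientedEdge → R) →ₗ[R] ℤ × ℤ → R where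
  toFun c v := ∑ i, (c ⟨i, v - unitVector i⟩ - c ⟨i, v⟩)
  map_add' c d := by ext v; simp only [Pi.add_apply, ← Finset.sum_add_distrib]; congr! 1; ring
  map_smul' r c := by
    ext v
    simp only [Pi.smul_apply, RingHom.id_apply, ← smul_sub, Finset.smul_sum]

theorem boundary_apply (c : OrientedEdge → R) (v : ℤ × ℤ) :
    boundary c v = ∑ i, (c ⟨i, v - unitVector i⟩ - c ⟨i, v⟩) := rfl

/-- The boundary of the `2`-chain with coefficient `φ p` at the plaquette `p`, each plaquette being
oriented counterclockwise. -/
def faceBoundary : (ℤ × ℤ → R) →ₗ[R] OrientedEdge → R where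
  toFun φ e := φ e.leftFace - φ e.rightFace
  map_add' φ ψ := by ext e; simp only [Pi.add_apply]; ring
  map_smul' r φ := by ext e; simp only [Pi.smul_apply, RingHom.id_apply, smul_sub]

theorem faceBoundary_apply (φ : ℤ × ℤ → R) (e : OrientedEdge) :
    faceBoundary φ e = φ e.leftFace - φ e.rightFace := rfl

theorem boundary_faceBoundary (φ : ℤ × ℤ → R) : boundary (faceBoundary φ) = 0 := by
  ext v
  simp only [boundary_apply, faceBoundary_apply, leftFace, rightFace, unitVector,
    Finset.sum_sub_distrib, Fin.sum_univ_two, Matrix.cons_val_zero, Matrix.cons_val_one,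
    Matrix.cons_val_fin_one, sub_zero, sub_right_comm v, Pi.zero_apply]
  ring

theorem boundary_single [DecidableEq OrientedEdge] (e : OrientedEdge) (r : R) :
    boundary (Pi.single e r) = Pi.single e.target r - Pi.single e.source r := by
  obtain ⟨j, p⟩ := e
  have hcoord (i : Fin 2) (v : ℤ × ℤ) :
      Pi.single (M := fun _ ↦ R) (⟨j, p⟩ : OrientedEdge) r ⟨i, v⟩ =
        if i = j then Pi.single (M := fun _ ↦ R) p r v else 0 := by
    simp only [Pi.single_apply, OrientedEdge.mk.injEq]
    split_ifs <;> simp_all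
  ext v
  simp [boundary_apply, hcoord, Pi.single_apply, Finset.sum_sub_distrib, target, sub_eq_iff_eq_add]

theorem finsum_boundary {c : OrientedEdge → R} (hc : c.HasFiniteSupport) :
    ∑ᶠ v, boundary c v = 0 := by
  have hout (i : Fin 2) : (fun v ↦ c ⟨i, v⟩).HasFiniteSupport :=
    hc.fun_comp_of_injective fun v w h ↦ (OrientedEdge.mk.inj h).2
  have hin (i : Fin 2) : (fun v ↦ c ⟨i, v - unitVector i⟩).HasFiniteSupport :=
    hc.fun_comp_of_injective fun v w h ↦ sub_left_injective (OrientedEdge.mk.inj h).2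
  simp only [boundary_apply]
  rw [finsum_sum_comm _ (fun v i ↦ c ⟨i, v - unitVector i⟩ - c ⟨i, v⟩)
    fun i _ ↦ (hin i).sub (hout i)]
  refine Finset.sum_eq_zero fun i _ ↦ ?_
  rw [finsum_sub_distrib (hin i) (hout i), sub_eq_zero]
  exact finsum_comp_equiv (Equiv.subRight (unitVector i)) (f := fun v ↦ c ⟨i, v⟩)

/-- The module of chains supported on the edges of `G`. -/
def chains (R : Type*) [CommRing R] (G : SimpleGraph (ℤ × ℤ)) : Submodule R (OrientedEdge → R) :=
  Submodule.pi {e | ¬G.Adj e.source e.target} fun _ ↦ ⊥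

theorem mem_chains_iff {c : OrientedEdge → R} :
    c ∈ chains R G ↔ ∀ e : OrientedEdge, ¬G.Adj e.source e.target → c e = 0 := by
  simp [chains, Submodule.mem_pi]

theorem boundary_mul_of_mem_chains {c : OrientedEdge → R} (hc : c ∈ chains R G) {s : ℤ × ℤ → R}
    (hs : ∀ u v, G.Adj u v → s u = s v) :
    boundary c * s = boundary fun e ↦ c e * s e.source := by
  have hcs (e : OrientedEdge) : c e * s e.target = c e * s e.source := by
    by_cases he : G.Adj e.source e.target
    · rw [hs _ _ he]
    · rw [mem_chains_iff.1 hc e he, zero_mul, zero_mul]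
  ext v
  simp only [Pi.mul_apply, boundary_apply, Finset.sum_mul, sub_mul]
  refine Finset.sum_congr rfl fun i _ ↦ congrArg (· - _) ?_
  simpa [target] using hcs ⟨i, v - unitVector i⟩

theorem finsum_boundary_mul_eq_zero {c : OrientedEdge → R} (hc : c ∈ chains R G)
    (hfin : c.HasFiniteSupport) {s : ℤ × ℤ → R} (hs : ∀ u v, G.Adj u v → s u = s v) :
    ∑ᶠ v, (boundary c * s) v = 0 := by
  rw [boundary_mul_of_mem_chains hc hs]
  exact finsum_boundary (hfin.subset fun e he ↦ left_ne_zero_of_mul he)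

theorem exists_mem_chains_of_adj (hG : G ≤ squareLattice) {u v : ℤ × ℤ} (huv : G.Adj u v) :
    ∃ c ∈ chains R G, c.HasFiniteSupport ∧ boundary c = Pi.single v 1 - Pi.single u 1 := by
  classical
  obtain ⟨e, he⟩ := adj_iff_exists_ends.1 (hG huv)
  have hsingle (r : R) : Pi.single e r ∈ chains R G := mem_chains_iff.2 fun e' he' ↦ by
    refine Pi.single_eq_of_ne (M := fun _ ↦ R) (fun h ↦ he' ?_) r
    rwa [h, ← SimpleGraph.mem_edgeSet, he]
  have hfin (r : R) : (Pi.single (M := fun _ ↦ R) e r).HasFiniteSupport :=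
    (Set.finite_singleton e).subset Pi.support_single_subset
  obtain ⟨rfl, rfl⟩ | ⟨rfl, rfl⟩ := Sym2.eq_iff.1 he
  · exact ⟨_, hsingle 1, hfin 1, boundary_single e 1⟩
  · exact ⟨_, hsingle (-1), hfin (-1), by rw [boundary_single, Pi.single_neg, Pi.single_neg]; abel⟩

theorem exists_mem_chains_of_reachable (hG : G ≤ squareLattice) {u v : ℤ × ℤ}
    (huv : G.Reachable u v) :
    ∃ c ∈ chains R G, c.HasFiniteSupport ∧ boundary c = Pi.single v 1 - Pi.single u 1 := by
  obtain ⟨p⟩ := huv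
  induction p with
  | nil => exact ⟨0, (chains R G).zero_mem, Function.hasFiniteSupport_fun_zero, by simp⟩
  | cons h _ ih =>
    obtain ⟨c, hc, hcfin, hcb⟩ := exists_mem_chains_of_adj (R := R) hG h
    obtain ⟨d, hd, hdfin, hdb⟩ := ih
    exact ⟨c + d, add_mem hc hd, hcfin.add hdfin, by rw [map_add, hcb, hdb]; abel⟩

theorem exists_mem_chains_of_infinite [Finite R] (hG : G ≤ squareLattice) {v : ℤ × ℤ}
    (hv : (G.connectedComponentMk v).supp.Infinite) :
    ∃ c ∈ chains R G, boundary c = -Pi.single v 1 := by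
  let x : ℕ → ℤ × ℤ := fun n ↦ hv.natEmbedding _ n
  have hx : x.Injective := Subtype.val_injective.comp (hv.natEmbedding _).injective
  choose p hp _ hpb using fun n ↦
    exists_mem_chains_of_reachable (R := R) hG
      (SimpleGraph.ConnectedComponent.exact (hv.natEmbedding _ n).2).symm
  -- The chains `p n` reach from `v` to `x n`, and `x n` escapes: a limit point is a ray from `v`.
  have hlim (e : OrientedEdge) : ∃ r, ∀ᶠ n in Filter.hyperfilter ℕ, p n e = r := by
    obtain ⟨r, hr⟩ := ((Filter.hyperfilter ℕ).map (p · e)).eq_pure_of_finite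
    have hmem : {r} ∈ (Filter.hyperfilter ℕ).map (p · e) := hr ▸ Ultrafilter.mem_pure.2 rfl
    exact ⟨r, hmem⟩
  choose c hc using hlim
  refine ⟨c, mem_chains_iff.2 fun e he ↦ ?_, funext fun w ↦ ?_⟩
  · obtain ⟨n, hn⟩ := (hc e).exists
    rw [← hn, mem_chains_iff.1 (hp n) e he]
  · have hescape : ∀ᶠ n in Filter.hyperfilter ℕ, x n ≠ w :=
      Filter.compl_mem_hyperfilter_of_finite <|
        (Set.finite_singleton w).preimage hx.injOn
    have hedges (i : Fin 2) : ∀ᶠ n in Filter.hyperfilter ℕ,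
        p n ⟨i, w - unitVector i⟩ = c ⟨i, w - unitVector i⟩ ∧ p n ⟨i, w⟩ = c ⟨i, w⟩ :=
      (hc _).and (hc _)
    obtain ⟨n, hn, hnw⟩ := ((Filter.eventually_all.2 hedges).and hescape).exists
    have hcn : boundary c w = boundary (p n) w := by
      simp only [boundary_apply, (hn _).1, (hn _).2]
    rw [hcn, hpb]
    simp [Pi.single_eq_of_ne hnw.symm, x]

theorem exists_forall_eq_sub_one_add {M : Type*} [AddGroup M] (f : ℤ → M) :
    ∃ F : ℤ → M, F 0 = 0 ∧ ∀ n, F n = F (n - 1) + f n := by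
  let σ : Equiv.Perm (ℤ × M) :=
    { toFun x := (x.1 + 1, x.2 + f (x.1 + 1))
      invFun x := (x.1 - 1, x.2 - f x.1)
      left_inv x := by simp
      right_inv x := by simp }
  have hstep (n : ℤ) : (σ ^ n) (0, 0) = σ ((σ ^ (n - 1)) (0, 0)) := by
    rw [← Equiv.Perm.mul_apply, mul_self_zpow, sub_add_cancel]
  have hfst (n : ℤ) : ((σ ^ n) (0, 0)).1 = n := by
    induction n with
    | zero => rfl
    | succ n ih => rw [hstep, add_sub_cancel_right]; exact congrArg (· + 1) ih
    | pred n ih => rw [hstep] at ih; exact eq_sub_of_add_eq ih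
  refine ⟨fun n ↦ ((σ ^ n) (0, 0)).2, rfl, fun n ↦ ?_⟩
  have hsnd : ((σ ^ n) (0, 0)).2 = _ := congrArg Prod.snd (hstep n)
  simpa only [σ, Equiv.coe_fn_mk, hfst, sub_add_cancel] using hsnd

theorem exists_faceBoundary_eq {c : OrientedEdge → R} (hc : boundary c = 0) :
    ∃ φ, faceBoundary φ = c := by
  choose B hB₀ hB using fun x ↦ exists_forall_eq_sub_one_add fun y ↦ c ⟨0, x, y⟩
  obtain ⟨A, -, hA⟩ := exists_forall_eq_sub_one_add fun x ↦ c ⟨1, x, 0⟩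
  have hvert (x y : ℤ) : c ⟨1, x, y⟩ + B x y - B (x - 1) y = c ⟨1, x, 0⟩ := by
    have hper : Function.Periodic (fun y ↦ c ⟨1, x, y⟩ + B x y - B (x - 1) y) 1 := fun y ↦ by
      have hdiv := congrFun hc (x, y + 1)
      simp only [boundary_apply, unitVector, Finset.sum_sub_distrib, Fin.sum_univ_two,
        Matrix.cons_val_zero, Matrix.cons_val_one, Matrix.cons_val_fin_one, Prod.mk_sub_mk,
        sub_zero, add_sub_cancel_right, Pi.zero_apply] at hdiv
      simp only [hB _ (y + 1), add_sub_cancel_right]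
      linear_combination -hdiv
    simpa [hB₀] using hper.int_mul_eq y
  refine ⟨fun p ↦ B p.1 p.2 - A p.1, funext ?_⟩
  rintro ⟨i, x, y⟩
  fin_cases i
  · simp [faceBoundary_apply, leftFace, rightFace, hB x y]
  · simp only [Fin.mk_one, faceBoundary_apply, leftFace, rightFace, Matrix.cons_val_one,
      Matrix.cons_val_fin_one, Prod.mk_sub_mk, sub_zero]
    linear_combination -hvert x y + hA x

end Chains

section Duality

open OrientedEdge

variable {G H : SimpleGraph (ℤ × ℤ)}

theorem preconnected_squareLattice : squareLattice.Preconnected := by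
  have hline (i : Fin 2) (v : ℤ × ℤ) (n : ℤ) :
      squareLattice.Reachable v (v + n • unitVector i) := by
    have hstep (n : ℤ) : squareLattice.Adj (v + n • unitVector i) (v + (n + 1) • unitVector i) :=
      adj_iff_exists_ends.2 ⟨⟨i, v + n • unitVector i⟩, by
        rw [target, add_one_zsmul, add_assoc]⟩
    induction n with
    | zero => rw [zero_zsmul, add_zero]
    | succ n ih => exact ih.trans (hstep n).reachable
    | pred n ih => exact ih.trans (by simpa using (hstep (-n - 1)).symm.reachable)
  intro u v
  convert (hline 0 u (v - u).1).trans (hline 1 _ (v - u).2)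
  ext <;> simp [unitVector]

theorem exists_faceBoundary_sub_mem_chains {R : Type*} [CommRing R] [Finite R]
    (hG : G ≤ squareLattice) {u v : ℤ × ℤ} (hu : (G.connectedComponentMk u).supp.Infinite)
    (hv : (G.connectedComponentMk v).supp.Infinite) :
    ∃ (φ : ℤ × ℤ → R) (p : OrientedEdge → R), p.HasFiniteSupport ∧
      boundary p = Pi.single v 1 - Pi.single u 1 ∧ faceBoundary φ - p ∈ chains R G := by
  obtain ⟨p, -, hpfin, hp⟩ :=
    exists_mem_chains_of_reachable (R := R) le_rfl (preconnected_squareLattice u v)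
  obtain ⟨c, hc, hcb⟩ := exists_mem_chains_of_infinite (R := R) hG hu
  obtain ⟨d, hd, hdb⟩ := exists_mem_chains_of_infinite (R := R) hG hv
  -- Two rays joined by `p` form a bi-infinite path, which is a cycle.
  obtain ⟨φ, hφ⟩ : ∃ φ, faceBoundary φ = p + (d - c) := exists_faceBoundary_eq <| by
    rw [map_add, map_sub, hp, hcb, hdb]; abel
  exact ⟨φ, p, hpfin, hp, by rw [hφ, add_sub_cancel_left]; exact sub_mem hd hc⟩

theorem finsum_boundary_linearCombination_mul {R ι : Type*} [CommRing R] [Fintype ι]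
    {p : ι → OrientedEdge → R} {u : ℤ × ℤ} {v : ι → ℤ × ℤ}
    (hp : ∀ i, boundary (p i) = Pi.single (v i) 1 - Pi.single u 1) (c : ι → R) (s : ℤ × ℤ → R) :
    ∑ᶠ w, (boundary (Fintype.linearCombination R p c) * s) w = ∑ i, c i * (s (v i) - s u) := by
  have hfin (x : ℤ × ℤ) (r : R) : (Pi.single (M := fun _ ↦ R) x r).HasFiniteSupport :=
    (Set.finite_singleton x).subset Pi.support_single_subset
  have hsum (x : ℤ × ℤ) (r : R) : ∑ᶠ w, Pi.single (M := fun _ ↦ R) x r w = r :=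
    (finsum_eq_single _ x fun w hw ↦ Pi.single_eq_of_ne (M := fun _ ↦ R) hw r).trans
      (Pi.single_eq_same (M := fun _ ↦ R) x r)
  have hps (i : ι) : c i • boundary (p i) * s =
      Pi.single (v i) (c i * s (v i)) - Pi.single u (c i * s u) := by
    rw [hp, smul_sub, sub_mul, ← Pi.single_smul, ← Pi.single_smul, ← Pi.single_mul_left,
      ← Pi.single_mul_left, smul_eq_mul, mul_one]
  simp only [Fintype.linearCombination_apply, map_sum, map_smul, Finset.sum_mul, hps,
    Finset.sum_apply]
  rw [finsum_sum_comm _ _ fun i _ ↦ (hfin _ _).sub (hfin _ _)]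
  refine Finset.sum_congr rfl fun i _ ↦ ?_
  simp only [Pi.sub_apply]
  rw [finsum_sub_distrib (hfin _ _) (hfin _ _), hsum, hsum, mul_sub]

theorem hasFiniteSupport_faceBoundary {R : Type*} [CommRing R] {φ : ℤ × ℤ → R}
    (hφ : φ.HasFiniteSupport) : (faceBoundary φ).HasFiniteSupport := by
  have hleft : Function.Injective fun e : OrientedEdge ↦ (e.direction, e.leftFace) := by
    rintro ⟨i, v⟩ ⟨j, w⟩ h
    obtain ⟨rfl : i = j, hvw⟩ := Prod.mk.inj h
    exact congrArg _ (sub_left_injective hvw)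
  have hright : Function.Injective fun e : OrientedEdge ↦ (e.direction, e.rightFace) := by
    rintro ⟨i, v⟩ ⟨j, w⟩ h
    obtain ⟨rfl : i = j, hvw⟩ := Prod.mk.inj h
    exact congrArg _ (sub_left_injective hvw)
  have hfin : (Set.univ ×ˢ φ.support : Set (Fin 2 × (ℤ × ℤ))).Finite := Set.finite_univ.prod hφ
  exact .sub ((hfin.preimage hleft.injOn).subset fun e he ↦ ⟨trivial, he⟩)
    ((hfin.preimage hright.injOn).subset fun e he ↦ ⟨trivial, he⟩)

theorem eq_of_mem_componentCompl {V M : Type*} {G : SimpleGraph V} {K : Set V} {φ : V → M}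
    (hφ : ∀ u ∉ K, ∀ v ∉ K, G.Adj u v → φ u = φ v) {D : G.ComponentCompl K} {u v : V}
    (hu : u ∈ D) (hv : v ∈ D) : φ u = φ v := by
  obtain ⟨_, hu⟩ := hu
  obtain ⟨_, hv⟩ := hv
  exact congrArg (SimpleGraph.ComponentCompl.lift (fun v _ ↦ φ v) fun v w hv hw ↦ hφ v hv w hw)
    (hu.trans hv.symm)

theorem exists_hasFiniteSupport_sub_eq {V M : Type*} [AddGroup M] {G : SimpleGraph V}
    (hG : ∀ v, (G.neighborSet v).Finite) {K : Set V} (hK : K.Finite) {φ : V → M}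
    (hφ : ∀ u ∉ K, ∀ v ∉ K, G.Adj u v → φ u = φ v)
    (hzero : ∀ D : G.ComponentCompl K, (D : Set V).Infinite → ∃ v ∈ D, φ v = 0) :
    ∃ ψ : V → M, ψ.HasFiniteSupport ∧ ∀ u v, G.Adj u v → (φ - ψ) u = (φ - ψ) v := by
  classical
  let T := {D : G.ComponentCompl K | (∃ v ∈ D, ∃ k ∈ K, G.Adj v k) ∧ (D : Set V).Finite}
  let F : Set V := K ∪ ⋃ D ∈ T, (D : Set V)
  have hF : F.Finite := hK.union <|
    ((finite_setOf_componentCompl_adj hG hK).subset fun D hD ↦ hD.1).biUnion fun D hD ↦ hD.2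
  have hleave {u v : V} (huv : G.Adj u v) (hu : u ∈ F) (hv : v ∉ F) : φ v = 0 := by
    obtain ⟨hvK, hvT⟩ := not_or.1 hv
    obtain huK | huT := hu
    · by_cases hfin : (G.componentComplMk hvK : Set V).Finite
      · exact (hvT <| Set.mem_biUnion (x := G.componentComplMk hvK)
          ⟨⟨v, G.componentComplMk_mem hvK, u, huK, huv.symm⟩, hfin⟩
          (G.componentComplMk_mem hvK)).elim
      · obtain ⟨w, hw, hw0⟩ := hzero _ hfin
        rw [eq_of_mem_componentCompl hφ (G.componentComplMk_mem hvK) hw, hw0]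
    · obtain ⟨D, hD, huD⟩ := Set.mem_iUnion₂.1 huT
      exact (hvT (Set.mem_biUnion hD (D.mem_of_adj u v huD hvK huv))).elim
  refine ⟨F.indicator φ, hF.subset Set.support_indicator_subset, fun u v huv ↦ ?_⟩
  rw [← Set.indicator_compl]
  by_cases hu : u ∈ F <;> by_cases hv : v ∈ F
  · simp [hu, hv]
  · simp [hu, hv, hleave huv hu hv]
  · simp [hu, hv, hleave huv.symm hv hu]
  · simpa [hu, hv] using hφ u (fun h ↦ hu (.inl h)) v (fun h ↦ hv (.inl h)) huv

/-- `H` is the planar dual of `G`: both are subgraphs of the square lattice, the vertices of `H`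
being plaquettes named by their lower left corners, and an edge of `H` is present if and only if the
edge that it crosses is missing from `G`. -/
structure IsPlanarDual (G H : SimpleGraph (ℤ × ℤ)) : Prop where
  le_left : G ≤ squareLattice
  le_right : H ≤ squareLattice
  adj_iff (e : OrientedEdge) : H.Adj e.leftFace e.rightFace ↔ ¬G.Adj e.source e.target

namespace IsPlanarDual

theorem faceBoundary_mem_chains {R : Type*} [CommRing R] (hGH : IsPlanarDual G H) {φ : ℤ × ℤ → R}
    (hφ : ∀ u v, H.Adj u v → φ u = φ v) : faceBoundary φ ∈ chains R G :=
  mem_chains_iff.2 fun e he ↦ sub_eq_zero.2 (hφ _ _ ((hGH.adj_iff e).2 he))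

theorem finsum_boundary_mul_eq_zero {R : Type*} [CommRing R] (hGH : IsPlanarDual G H)
    {K : Set (ℤ × ℤ)} (hK : K.Finite) {φ : ℤ × ℤ → R} {p : OrientedEdge → R}
    (hp : p.HasFiniteSupport) (hpK : ∀ e : OrientedEdge, e.leftFace ∉ K → p e = 0)
    (hφp : faceBoundary φ - p ∈ chains R G)
    (hzero : ∀ D : H.ComponentCompl K, (D : Set (ℤ × ℤ)).Infinite → ∃ v ∈ D, φ v = 0)
    {s : ℤ × ℤ → R} (hs : ∀ u v, G.Adj u v → s u = s v) :
    ∑ᶠ v, (boundary p * s) v = 0 := by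
  have hφ : ∀ u ∉ K, ∀ v ∉ K, H.Adj u v → φ u = φ v := by
    intro u hu v hv huv
    obtain ⟨e, he⟩ := adj_iff_exists_faces.1 (hGH.le_right huv)
    have hopen : H.Adj e.leftFace e.rightFace := by
      rwa [← SimpleGraph.mem_edgeSet, he]
    have hleft : e.leftFace ∉ K := by
      obtain ⟨h, -⟩ | ⟨h, -⟩ := Sym2.eq_iff.1 he <;> rwa [h]
    have heq : φ e.leftFace = φ e.rightFace := by
      have := mem_chains_iff.1 hφp e ((hGH.adj_iff e).1 hopen)
      rwa [Pi.sub_apply, hpK e hleft, sub_zero, faceBoundary_apply, sub_eq_zero] at this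
    obtain ⟨rfl, rfl⟩ | ⟨rfl, rfl⟩ := Sym2.eq_iff.1 he
    exacts [heq, heq.symm]
  obtain ⟨ψ, hψ, hsub⟩ := exists_hasFiniteSupport_sub_eq
    (finite_neighborSet_of_le_squareLattice hGH.le_right) hK hφ hzero
  have hmem : p - faceBoundary ψ ∈ chains R G := by
    have := sub_mem (hGH.faceBoundary_mem_chains hsub) hφp
    rwa [map_sub, sub_sub_sub_cancel_left] at this
  have hboundary : boundary (p - faceBoundary ψ) = boundary p := by
    rw [map_sub, boundary_faceBoundary, sub_zero]
  rw [← hboundary]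
  exact Percolation.finsum_boundary_mul_eq_zero hmem (hp.sub (hasFiniteSupport_faceBoundary hψ)) hs

theorem eq_zero_of_linearCombination_eq_zero {R ι : Type*} [CommRing R] [Fintype ι]
    (hGH : IsPlanarDual G H) {K : Set (ℤ × ℤ)} (hK : K.Finite) {φ : ι → ℤ × ℤ → R}
    {p : ι → OrientedEdge → R} (hp : ∀ i, (p i).HasFiniteSupport)
    (hpK : ∀ i, ∀ e : OrientedEdge, e.leftFace ∉ K → p i e = 0)
    (hφp : ∀ i, faceBoundary (φ i) - p i ∈ chains R G) {v : Option ι → ℤ × ℤ}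
    (hv : Function.Injective fun i ↦ G.connectedComponentMk (v i))
    (hpv : ∀ i, boundary (p i) = Pi.single (v (some i)) 1 - Pi.single (v none) 1) {c : ι → R}
    (hzero : ∀ D : H.ComponentCompl K, (D : Set (ℤ × ℤ)).Infinite →
      ∃ w ∈ D, Fintype.linearCombination R φ c w = 0) : c = 0 := by
  classical
  funext j
  let s : ℤ × ℤ → R := fun w ↦
    if G.connectedComponentMk w = G.connectedComponentMk (v (some j)) then 1 else 0
  have hs (i : Option ι) : s (v i) = if i = some j then 1 else 0 := by
    simp only [s, hv.eq_iff (a := i) (b := some j)]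
  have hpair := finsum_boundary_linearCombination_mul hpv c s
  simp only [hs, Option.some.injEq, reduceCtorEq, if_false, sub_zero, mul_ite, mul_one, mul_zero,
    Finset.sum_ite_eq', Finset.mem_univ, if_true] at hpair
  rw [Pi.zero_apply, ← hpair]
  refine hGH.finsum_boundary_mul_eq_zero hK ?_ ?_ ?_ hzero ?_
  · refine (Set.finite_iUnion hp).subset fun e he ↦ ?_
    contrapose! he
    simp_all [Fintype.linearCombination_apply]
  · intro e he
    simp [Fintype.linearCombination_apply, hpK _ e he]
  · rw [Fintype.linearCombination_apply, Fintype.linearCombination_apply, map_sum,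
      ← Finset.sum_sub_distrib]
    refine sum_mem fun i _ ↦ ?_
    rw [map_smul, ← smul_sub]
    exact (chains R G).smul_mem _ (hφp i)
  · intro x y hxy
    simp only [s, SimpleGraph.ConnectedComponent.sound hxy.reachable]

theorem exists_finset_forall_card_le (hGH : IsPlanarDual G H) {ι : Type*} [Fintype ι]
    {C : Option ι → G.ConnectedComponent} (hC : C.Injective) (hinf : ∀ i, (C i).supp.Infinite) :
    ∃ K : Finset (ℤ × ℤ), ∀ t : Finset (H.ComponentCompl (K : Set (ℤ × ℤ))),
      (∀ D : H.ComponentCompl (K : Set (ℤ × ℤ)), (D : Set (ℤ × ℤ)).Infinite → D ∈ t) →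
        Fintype.card ι ≤ t.card := by
  let R := ZMod 2
  choose v hv using fun i ↦ (C i).exists_rep
  obtain rfl : (fun i ↦ G.connectedComponentMk (v i)) = C := funext hv
  choose φ p hp hpv hφp using fun i : ι ↦
    exists_faceBoundary_sub_mem_chains (R := R) hGH.le_left (hinf none) (hinf (some i))
  have hK : (⋃ i, leftFace '' (p i).support).Finite :=
    Set.finite_iUnion fun i ↦ (hp i).image leftFace
  have hpK (i : ι) (e : OrientedEdge) (he : e.leftFace ∉ (hK.toFinset : Set (ℤ × ℤ))) :
      p i e = 0 := by
    contrapose! he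
    rw [hK.coe_toFinset]
    exact Set.mem_iUnion_of_mem i ⟨e, he, rfl⟩
  refine ⟨hK.toFinset, fun t ht ↦ ?_⟩
  -- The potentials `φ i` are linearly independent as functions on the infinite components.
  let Φ : (ι → R) →ₗ[R] t → R :=
    LinearMap.funLeft R R (fun D : t ↦ D.1.nonempty.some) ∘ₗ Fintype.linearCombination R φ
  have hΦ : Function.Injective Φ := (injective_iff_map_eq_zero Φ).2 fun c hc ↦
    hGH.eq_zero_of_linearCombination_eq_zero hK.toFinset.finite_toSet hp hpK hφp hC hpv
      fun D hD ↦ ⟨_, D.nonempty.some_mem, congrFun hc ⟨D, ht D hD⟩⟩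
  simpa using card_le_of_injective R Φ hΦ

theorem infinite_infiniteComponents (hGH : IsPlanarDual G H) (hno : ∀ K, ¬IsBranching H K)
    (hG : (infiniteComponents G).Infinite) : (infiniteComponents H).Infinite := by
  intro hH
  let N := 2 * (infiniteComponents H).ncard
  have : Infinite (infiniteComponents G) := hG.to_subtype
  let C : Option (Fin (N + 1)) ↪ infiniteComponents G :=
    (finSuccEquiv (N + 1)).symm.toEmbedding.trans <| Fin.valEmbedding.trans <|
      Infinite.natEmbedding _
  obtain ⟨K, hK⟩ := hGH.exists_finset_forall_card_le
    (Subtype.val_injective.comp C.injective) fun i ↦ (C i).2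
  have hcard (t : Finset (H.ComponentCompl (K : Set (ℤ × ℤ))))
      (ht : ∀ D ∈ t, (D : Set (ℤ × ℤ)).Infinite) : t.card ≤ N :=
    card_le_of_forall_not_isBranching (finite_neighborSet_of_le_squareLattice hGH.le_right) hno hH
      t ht
  have hfin : {D : H.ComponentCompl (K : Set (ℤ × ℤ)) | (D : Set (ℤ × ℤ)).Infinite}.Finite := by
    by_contra hinf
    obtain ⟨t, ht, htcard⟩ := Set.Infinite.exists_subset_card_eq hinf (N + 1)
    exact (hcard t ht).not_gt (htcard ▸ N.lt_succ_self)
  have hle := (hK hfin.toFinset fun D hD ↦ hfin.mem_toFinset.2 hD).trans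
    (hcard _ fun D hD ↦ hfin.mem_toFinset.1 hD)
  simp at hle

end IsPlanarDual

end Duality

section Lattice

open OrientedEdge

theorem squareLattice_adj_sub_iff {u v : ℤ × ℤ} (t : ℤ × ℤ) :
    squareLattice.Adj (u - t) (v - t) ↔ squareLattice.Adj u v := by
  simp only [squareLattice_adj, Prod.fst_sub, Prod.snd_sub]
  omega

namespace IsPlanarDual

variable {G H H' : SimpleGraph (ℤ × ℤ)}

theorem le_of_isPlanarDual (hGH : IsPlanarDual G H) (hGH' : IsPlanarDual G H') : H ≤ H' := by
  intro u v huv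
  obtain ⟨e, he⟩ := adj_iff_exists_faces.1 (hGH.le_right huv)
  rw [← SimpleGraph.mem_edgeSet, ← he, SimpleGraph.mem_edgeSet] at huv ⊢
  exact (hGH'.adj_iff e).2 ((hGH.adj_iff e).1 huv)

theorem unique (hGH : IsPlanarDual G H) (hGH' : IsPlanarDual G H') : H = H' :=
  (hGH.le_of_isPlanarDual hGH').antisymm (hGH'.le_of_isPlanarDual hGH)

theorem comap_subRight (hGH : IsPlanarDual G H) (t : ℤ × ℤ) :
    IsPlanarDual (G.comap (Equiv.subRight t)) (H.comap (Equiv.subRight t)) where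
  le_left _ _ h := (squareLattice_adj_sub_iff t).1 (hGH.le_left h)
  le_right _ _ h := (squareLattice_adj_sub_iff t).1 (hGH.le_right h)
  adj_iff e := by
    simpa only [SimpleGraph.comap_adj, Equiv.subRight_apply, leftFace, rightFace, target,
      sub_right_comm _ _ t, add_sub_right_comm _ _ t] using
      hGH.adj_iff ⟨e.direction, e.source - t⟩

-- Plaquettes are named by their lower left corners, so taking the dual twice shifts by `(1, 1)`.
theorem symm_comap_subRight (hGH : IsPlanarDual G H) :
    IsPlanarDual (H.comap (Equiv.subRight ((1 : ℤ), (1 : ℤ)))) G where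
  le_left _ _ h := (squareLattice_adj_sub_iff (1, 1)).1 (hGH.le_right h)
  le_right := hGH.le_left
  adj_iff := by
    rintro ⟨i, a, b⟩
    fin_cases i
    · rw [SimpleGraph.adj_comm G]
      simpa [leftFace, rightFace, target, unitVector] using
        iff_not_comm.1 (hGH.adj_iff ⟨1, a, b - 1⟩)
    · rw [SimpleGraph.adj_comm (H.comap _)]
      simpa [leftFace, rightFace, target, unitVector] using
        iff_not_comm.1 (hGH.adj_iff ⟨0, a - 1, b⟩)

end IsPlanarDual

theorem infinite_infiniteComponents_iff {V W : Type*} {G : SimpleGraph V} {H : SimpleGraph W}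
    (f : G ≃g H) : (infiniteComponents G).Infinite ↔ (infiniteComponents H).Infinite :=
  not_congr (f.connectedComponentEquiv.subtypeEquiv fun C ↦
    not_congr (C.isoEquivSupp f).set_finite_iff).set_finite_iff

end Lattice

section Configurations

open OrientedEdge

theorem openSubgraph_adj {V : Type*} {G : SimpleGraph V} {ω : Config G} {u v : V} :
    (openSubgraph ω).Adj u v ↔ ∃ h : G.Adj u v, ω ⟨s(u, v), h⟩ = true :=
  (SimpleGraph.fromEdgeSet_adj _).trans
    ⟨And.left, fun h ↦ ⟨h, h.1.ne⟩⟩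

theorem openSubgraph_le {V : Type*} {G : SimpleGraph V} (ω : Config G) : openSubgraph ω ≤ G :=
  fun _ _ h ↦ (openSubgraph_adj.1 h).1

theorem measurable_openSubgraph_adj {V : Type*} {G : SimpleGraph V} (u v : V) :
    Measurable fun ω : Config G ↦ (openSubgraph ω).Adj u v := by
  simp only [openSubgraph_adj]
  exact .exists fun h ↦ (measurable_of_countable (· = true)).comp (measurable_pi_apply _)

theorem openSubgraph_translate (t : ℤ × ℤ) (ω : Config squareLattice) :
    openSubgraph (translate t ω) = (openSubgraph ω).comap (Equiv.subRight t) := by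
  ext u v
  rw [SimpleGraph.comap_adj, openSubgraph_adj, openSubgraph_adj]
  exact ⟨fun ⟨h, hω⟩ ↦ ⟨(squareLattice_adj_sub_iff t).2 h, hω⟩,
    fun ⟨h, hω⟩ ↦ ⟨(squareLattice_adj_sub_iff t).1 h, hω⟩⟩

theorem dualEdge_mk (e : OrientedEdge) (h : squareLattice.Adj e.source e.target) :
    (dualEdge ⟨s(e.source, e.target), h⟩ : Sym2 Plaquette) = s(e.leftFace, e.rightFace) := by
  obtain ⟨i, a, b⟩ := e
  fin_cases i <;> simp [dualEdge, leftFace, rightFace, target, unitVector, Sym2.eq_swap]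

theorem isPlanarDual_openSubgraph (ω : Config squareLattice) :
    IsPlanarDual (openSubgraph ω) (openSubgraph (dualConfig ω)) where
  le_left := openSubgraph_le ω
  le_right _ _ h := (dualLattice_adj _ _).1 (openSubgraph_le _ h)
  adj_iff e := by
    have hprimal : squareLattice.Adj e.source e.target := adj_iff_exists_ends.2 ⟨e, rfl⟩
    have hdual : dualLattice.Adj e.leftFace e.rightFace :=
      (dualLattice_adj _ _).2 (adj_iff_exists_faces.2 ⟨e, rfl⟩)
    have hcross : dualEdge.symm ⟨s(e.leftFace, e.rightFace), hdual⟩ =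
        ⟨s(e.source, e.target), hprimal⟩ :=
      dualEdge.symm_apply_eq.2 (Subtype.ext (dualEdge_mk e hprimal).symm)
    simp only [openSubgraph_adj, exists_prop_of_true hprimal, exists_prop_of_true hdual,
      dualConfig, hcross, Bool.not_eq_true', Bool.not_eq_true]

theorem openSubgraph_dualConfig_translate (t : ℤ × ℤ) (ω : Config squareLattice) :
    openSubgraph (dualConfig (translate t ω)) =
      (openSubgraph (dualConfig ω)).comap (Equiv.subRight t) :=
  (isPlanarDual_openSubgraph (translate t ω)).unique <|
    openSubgraph_translate t ω ▸ (isPlanarDual_openSubgraph ω).comap_subRight t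

theorem dualMeasure_apply (μ : Measure (Config squareLattice)) (S : Set (Config dualLattice)) :
    dualMeasure μ S = μ (dualConfig ⁻¹' S) := by
  let f : Config squareLattice ≃ᵐ Config dualLattice :=
    { toFun := dualConfig
      invFun η e := !η (dualEdge e)
      left_inv ω := funext fun e ↦ by simp [dualConfig]
      right_inv η := funext fun f ↦ by simp [dualConfig]
      measurable_toFun := measurable_dualConfig
      measurable_invFun := measurable_pi_lambda _ fun e ↦
        (measurable_of_countable Bool.not).comp (measurable_pi_apply (dualEdge e)) }
  exact f.map_apply S

end Configurations

end Percolation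

open Percolation in
theorem lemma2p5_general (μ : Measure (Config squareLattice)) [IsFiniteMeasure μ]
    (hμ : TranslationInvariant μ) :
    ∀ᵐ ω ∂μ, HasInfinitelyManyInfiniteClusters ω ↔
      HasInfinitelyManyInfiniteClusters (dualConfig ω) := by
  have hprimal := ae_forall_not_isBranching measurable_openSubgraph_adj openSubgraph_le hμ
    openSubgraph_translate
  have hdual := ae_forall_not_isBranching (X := fun ω ↦ openSubgraph (dualConfig ω))
    (fun u v ↦ (measurable_openSubgraph_adj u v).comp measurable_dualConfig)
    (fun ω ↦ (isPlanarDual_openSubgraph ω).le_right) hμ openSubgraph_dualConfig_translate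
  filter_upwards [hprimal, hdual] with ω hω hω'
  have hGH := isPlanarDual_openSubgraph ω
  exact ⟨hGH.infinite_infiniteComponents hω', fun h ↦
    hGH.symm_comap_subRight.infinite_infiniteComponents hω
      ((infinite_infiniteComponents_iff (.comap _ _)).2 h)⟩

theorem lemma2p5 (μ : MeasureTheory.Measure (Percolation.Config Percolation.squareLattice))
    [MeasureTheory.IsProbabilityMeasure μ] (hμ : Percolation.TranslationInvariant μ) :
    0 < μ {ω | Percolation.HasInfinitelyManyInfiniteClusters ω} ↔
      0 < Percolation.dualMeasure μ {η | Percolation.HasInfinitelyManyInfiniteClusters η} := by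
  rw [Percolation.dualMeasure_apply]
  exact iff_of_eq (congrArg _ (measure_congr (lemma2p5_general μ hμ).set_eq))
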